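/- Let $\Lambda=(\lambda_i)_{i\ge 0}$ be a Müntz sequence, i.e. a strictly increasing sequence of real numbers with $\lambda_0=0$ and $\sum_{i\ge 1}1/\lambda_i<\infty$, and suppose that $\lambda_1\ge 1$. Let $\Pi(\Lambda)=\mathrm{span}\{t^{\lambda_i}:i\ge 0\}\subseteq C[0,1]$ (real-valued continuous functions with the sup norm $\|\cdot\|_\infty$), let $M(\Lambda)$ be the closure of $\Pi(\Lambda)$ in $C[0,1]$, and let $c$ be the Banach space of convergent real sequences with the sup norm. Then $M(\Lambda)$ is almost isometric to a subspace of $c$: for every $\varepsilon>0$ there is a bounded linear operator $J_\varepsilon:M(\Lambda)\to c$ with $$(1-\varepsilon)\|f\|_\infty\le\|J_\varepsilon f\|\le\|f\|_\infty\qquad\text{for all } f\in M(\Lambda).$$ Moreover, $J_\varepsilon$ can be taken to be a sampling operator, as follows. Let $0=a_0<a_1<a_2<\cdots<1$ be any sequence converging to $1$. Then there are constants $K_i>0$ ($i\ge 0$), not depending on $\varepsilon$, such that every $p\in\Pi(\Lambda)$ is differentiable on $[0,a_i]$ (one-sidedly at $0$) and $$\sup_{t\in[0,a_i]}|p'(t)|\le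 K_i\|p\|_\infty\qquad\text{for all } p\in\Pi(\Lambda),\ i\ge 0,$$ and such that for every $\varepsilon>0$ there are points $0=s_0<s_1<s_2<\cdots$ in $[0,1]$ and indices $0=n_0<n_1<n_2<\cdots$ with $s_{n_i}=a_i$ for all $i$ and $s_{j+1}-s_j\le\varepsilon/K_{i+1}$ whenever $n_i\le j<n_{i+1}$, for which $J_\varepsilon f=(f(s_k))_{k\ge 0}$ defines a bounded linear operator $M(\Lambda)\to c$ satisfying the two inequalities above. -/

import Mathlib

open Set Filter Topology
open scoped BoundedContinuousFunction

/-- A Müntz sequence: a strictly increasing sequence `0 = l 0 < l 1 < l 2 < ⋯` of real numbers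
with `∑_{i ≥ 1} 1 / l i < ∞`. -/
structure MuntzSequence where
  toFun : ℕ → ℝ
  zero' : toFun 0 = 0
  strictMono' : StrictMono toFun
  summable' : Summable fun i : ℕ => 1 / toFun (i + 1)

namespace MuntzSequence

instance : CoeFun MuntzSequence fun _ => ℕ → ℝ := ⟨MuntzSequence.toFun⟩

theorem nonneg (Λ : MuntzSequence) (i : ℕ) : 0 ≤ Λ i := by
  have h := Λ.strictMono'.monotone (Nat.zero_le i)
  rwa [Λ.zero'] at h

/-- The function `t ↦ t ^ (Λ i)` in `C[0,1]` (the constant `1` for `i = 0`). -/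
noncomputable def monomial (Λ : MuntzSequence) (i : ℕ) : C(unitInterval, ℝ) where
  toFun t := (t : ℝ) ^ (Λ i)
  continuous_toFun := continuous_subtype_val.rpow_const fun _ => Or.inr (Λ.nonneg i)

/-- `Π(Λ)`: the linear span of the functions `t ^ (Λ i)`, `i ≥ 0`, in `C[0,1]`. -/
noncomputable def polynomials (Λ : MuntzSequence) : Submodule ℝ C(unitInterval, ℝ) :=
  Submodule.span ℝ (range Λ.monomial)

/-- The Müntz space `M(Λ)`: the closure of `Π(Λ)` in `C[0,1]` for the sup norm. -/
noncomputable def space (Λ : MuntzSequence) : Submodule ℝ C(unitInterval, ℝ) :=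
  Λ.polynomials.topologicalClosure

/-- `K` is a Bernstein constant for `Π(Λ)` on `[0, b]`: every `p ∈ Π(Λ)` is differentiable at each
point of `[0, b]` (relative to `[0, 1]`), and `sup_{[0, b]} |p'| ≤ K ‖p‖_∞`. -/
def IsBernsteinConstant (Λ : MuntzSequence) (b K : ℝ) : Prop :=
  ∀ p ∈ Λ.polynomials, ∀ t ∈ Icc (0 : ℝ) b,
    ∃ d : ℝ, HasDerivWithinAt (IccExtend (zero_le_one' ℝ) p) d (Icc 0 1) t ∧ |d| ≤ K * ‖p‖

end MuntzSequence

/-- The space `c` of convergent real sequences with the sup norm, as a subspace of the space of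
bounded sequences. -/
def convergentSeq : Submodule ℝ (ℕ →ᵇ ℝ) where
  carrier := {x | ∃ l : ℝ, Tendsto x atTop (𝓝 l)}
  add_mem' := by
    rintro x y ⟨l, hl⟩ ⟨m, hm⟩
    exact ⟨l + m, hl.add hm⟩
  zero_mem' := ⟨0, tendsto_const_nhds⟩
  smul_mem' := by
    rintro r x ⟨l, hl⟩
    exact ⟨r • l, hl.const_smul r⟩

/-!
The substance of the theorem is the bounded Bernstein inequality: for `b < 1` the derivative of a
Müntz polynomial on `[0, b]` is controlled by its sup norm on `[0, 1]`
(`MuntzSequence.exists_isBernsteinConstant`). Given it, sampling at points that are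
`ε / K (i + 1)` close on `[a i, a (i + 1)]` loses at most `ε ‖p‖` of the norm of a polynomial `p`,
and density of the polynomials finishes the argument
(`MuntzSequence.sub_mul_norm_le_norm_samplingCLM`).

No gap condition is imposed on the exponents, so the coefficients cannot be estimated one at a
time with geometric bounds. Instead, functions `f` of the exponent are regarded as multipliers
`∑ c l * t ^ l ↦ ∑ c l * f l * t ^ l`, and `MultiplierBound` records upper bounds for their
operator norms, which are submultiplicative. Only the values of `f` on the set of exponents
matter, so the dilation `p ↦ p (β * ·)`, with multiplier `β ^ l`, may be replaced by any operator
whose multiplier interpolates `β ^ l` at the exponents.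

For the exponents in a dyadic block, such an operator is found by Newton interpolation of a
holomorphic function (`exists_multiplierBound_eq_rpow_of_dyadic`). It is built from an averaging
operator, so it remains bounded after applying `t d/dt`, and it is exponentially small once the
dilation is strong compared with the number of exponents in the block. A strength of order
`n / 2 ^ b` is enough for `n` exponents in `[2 ^ b, 2 ^ (b + 1))`, and the sum of these over the
blocks is controlled by `∑ 1 / Λ i`. Multiplying the differences between dilations and
interpolating operators (`exists_multiplierBound_eq_prod_rpow`) shows that the dilation by any
fixed `β < 1`, even followed by `t d/dt`, has small norm on the span of sufficiently high
exponents (`MuntzSequence.exists_tail_multiplierBound`).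

This makes each coefficient functional bounded (`MuntzSequence.exists_multiplierBound_indicator`),
so a polynomial splits boundedly into finitely many low terms and a high part. The derivative of
the low terms is bounded since `Λ 1 ≥ 1`. For the high part, powers of the dilation by `β`, of
norm at most `β`, reach every point of `(0, b]` and compensate for the factor `x⁻¹` in
`p' x = x⁻¹ * (x * p' x)`.
-/

/-! ### Multiplier norms on generalized polynomials -/

/-- `MultiplierBound A f C`: on the generalized polynomials `∑ c l * t ^ l` with finitely many
exponents `l ∈ A`, the diagonal operator multiplying the coefficient of `t ^ l` by `f l` has norm
at most `C` for the sup norm on `(0, 1]`. Leaving out `t = 0` avoids the convention `0 ^ 0 = 1`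
and does not change the sup norm when `A ⊆ [0, ∞)`. The sup norm is encoded by its upper bounds
`M`. -/
def MultiplierBound (A : Set ℝ) (f : ℝ → ℝ) (C : ℝ) : Prop :=
  ∀ (F : Finset ℝ), (F : Set ℝ) ⊆ A → ∀ (c : ℝ → ℝ) (M : ℝ),
    (∀ t ∈ Ioc (0 : ℝ) 1, |∑ l ∈ F, c l * t ^ l| ≤ M) →
      ∀ t ∈ Ioc (0 : ℝ) 1, |∑ l ∈ F, c l * f l * t ^ l| ≤ C * M

namespace MultiplierBound

variable {A B : Set ℝ} {f g : ℝ → ℝ} {C D : ℝ}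

theorem nonneg_of_bound {F : Finset ℝ} {c : ℝ → ℝ} {M : ℝ}
    (h : ∀ t ∈ Ioc (0 : ℝ) 1, |∑ l ∈ F, c l * t ^ l| ≤ M) : 0 ≤ M :=
  (abs_nonneg _).trans (h 1 ⟨one_pos, le_rfl⟩)

theorem mono_set (h : MultiplierBound B f C) (hAB : A ⊆ B) : MultiplierBound A f C :=
  fun F hF => h F (hF.trans hAB)

theorem mono (h : MultiplierBound A f C) (hCD : C ≤ D) : MultiplierBound A f D :=
  fun F hF c M hM t ht =>
    (h F hF c M hM t ht).trans (mul_le_mul_of_nonneg_right hCD (nonneg_of_bound hM))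

theorem congr (h : MultiplierBound A f C) (hfg : ∀ l ∈ A, f l = g l) :
    MultiplierBound A g C := by
  intro F hF c M hM t ht
  have : ∑ l ∈ F, c l * g l * t ^ l = ∑ l ∈ F, c l * f l * t ^ l :=
    Finset.sum_congr rfl fun l hl => by rw [hfg l (hF hl)]
  rw [this]
  exact h F hF c M hM t ht

theorem add (hf : MultiplierBound A f C) (hg : MultiplierBound A g D) :
    MultiplierBound A (fun l => f l + g l) (C + D) := by
  intro F hF c M hM t ht
  have := (abs_add_le _ _).trans (add_le_add (hf F hF c M hM t ht) (hg F hF c M hM t ht))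
  rw [← Finset.sum_add_distrib] at this
  rw [add_mul]
  refine le_trans (le_of_eq ?_) this
  congr 1
  exact Finset.sum_congr rfl fun l _ => by ring

/-- If `f` vanishes on `A \ B`, its operator maps into the span of the exponents in `B`, so that
only the bound for `g` on `B` matters. -/
theorem mul_of_support (hf : MultiplierBound A f C) (hsupp : ∀ l ∈ A, l ∉ B → f l = 0)
    (hg : MultiplierBound B g D) : MultiplierBound A (fun l => f l * g l) (C * D) := by
  classical
  intro F hF c M hM t ht
  have key : ∀ (u : ℝ → ℝ), ∑ l ∈ F, c l * f l * u l = ∑ l ∈ F with l ∈ B, c l * f l * u l := by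
    intro u
    refine (Finset.sum_filter_of_ne fun l hl hne => ?_).symm
    by_contra hlB
    exact hne (by rw [hsupp l (hF hl) hlB]; ring)
  have h1 : ∀ t ∈ Ioc (0 : ℝ) 1, |∑ l ∈ F with l ∈ B, c l * f l * t ^ l| ≤ C * M := by
    intro t ht
    rw [← key]
    exact hf F hF c M hM t ht
  have h2 := hg (F.filter (· ∈ B)) (fun l hl => (Finset.mem_filter.1 hl).2) _ _ h1 t ht
  have h3 : ∑ l ∈ F, c l * (f l * g l) * t ^ l = ∑ l ∈ F, c l * f l * (g l * t ^ l) :=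
    Finset.sum_congr rfl fun l _ => by ring
  rw [h3, key, ← Finset.sum_congr rfl fun l _ => mul_assoc (c l * f l) (g l) (t ^ l)]
  exact h2.trans (le_of_eq (by ring))

theorem mul (hf : MultiplierBound A f C) (hg : MultiplierBound A g D) :
    MultiplierBound A (fun l => f l * g l) (C * D) :=
  hf.mul_of_support (fun _ hl hn => absurd hl hn) hg

theorem const (A : Set ℝ) (r : ℝ) : MultiplierBound A (fun _ => r) |r| := by
  intro F hF c M hM t ht
  have : ∑ l ∈ F, c l * r * t ^ l = r * ∑ l ∈ F, c l * t ^ l := by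
    rw [Finset.mul_sum]
    exact Finset.sum_congr rfl fun l _ => by ring
  rw [this, abs_mul]
  exact mul_le_mul_of_nonneg_left (hM t ht) (abs_nonneg r)

theorem const_mul (r : ℝ) (hf : MultiplierBound A f C) :
    MultiplierBound A (fun l => r * f l) (|r| * C) :=
  (const A r).mul hf

theorem sub (hf : MultiplierBound A f C) (hg : MultiplierBound A g D) :
    MultiplierBound A (fun l => f l - g l) (C + D) := by
  have := hf.add (hg.const_mul (-1))
  simp only [abs_neg, abs_one, one_mul] at this
  exact this.congr fun l _ => by ring

theorem sum {ι : Type*} (s : Finset ι) (f : ι → ℝ → ℝ) (C : ι → ℝ)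
    (h : ∀ i ∈ s, MultiplierBound A (f i) (C i)) :
    MultiplierBound A (fun l => ∑ i ∈ s, f i l) (∑ i ∈ s, C i) := by
  classical
  induction s using Finset.induction_on with
  | empty => simpa using const A 0
  | insert i s hi ih =>
    have := (h i (Finset.mem_insert_self i s)).add
      (ih fun j hj => h j (Finset.mem_insert_of_mem hj))
    simpa only [Finset.sum_insert hi] using this

theorem pow (hf : MultiplierBound A f C) (k : ℕ) :
    MultiplierBound A (fun l => f l ^ k) (C ^ k) := by
  induction k with
  | zero => simpa using const A 1
  | succ k ih => simpa only [pow_succ] using ih.mul hf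

/-- The multiplier `x ^ l` is the dilation `p ↦ p (x * ·)`. -/
theorem rpow (A : Set ℝ) {x : ℝ} (hx : x ∈ Ioc (0 : ℝ) 1) :
    MultiplierBound A (fun l => x ^ l) 1 := by
  intro F hF c M hM t ht
  have : ∑ l ∈ F, c l * x ^ l * t ^ l = ∑ l ∈ F, c l * (x * t) ^ l :=
    Finset.sum_congr rfl fun l _ => by rw [Real.mul_rpow hx.1.le ht.1.le, mul_assoc]
  rw [this, one_mul]
  exact hM _ ⟨mul_pos hx.1 ht.1, mul_le_one₀ hx.2 ht.1.le ht.2⟩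

/-- The multiplier `1 / (1 + l τ)` is the averaging operator
`p ↦ τ⁻¹ ∫₀¹ s ^ (τ⁻¹ - 1) p (s * ·) ds`. -/
theorem inv_one_add {τ : ℝ} (hτ : 0 < τ) :
    MultiplierBound (Ici 0) (fun l => (1 + l * τ)⁻¹) 1 := by
  intro F hF c M hM t ht
  have ha : 0 < τ⁻¹ := inv_pos.2 hτ
  have hF' : ∀ l ∈ F, 0 ≤ l := fun l hl => hF hl
  have hint : ∀ l, 0 ≤ l →
      IntervalIntegrable (fun s : ℝ => s ^ (l + τ⁻¹ - 1)) MeasureTheory.volume 0 1 :=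
    fun l hl => intervalIntegral.intervalIntegrable_rpow' (by linarith)
  have hval : ∀ l, 0 ≤ l → ∫ s in (0 : ℝ)..1, s ^ (l + τ⁻¹ - 1) = (l + τ⁻¹)⁻¹ := by
    intro l hl
    rw [integral_rpow (Or.inl (by linarith)), sub_add_cancel, Real.one_rpow,
      Real.zero_rpow (by positivity)]
    simp
  have h1 : ∑ l ∈ F, c l * (1 + l * τ)⁻¹ * t ^ l
      = τ⁻¹ * ∫ s in (0 : ℝ)..1, ∑ l ∈ F, c l * t ^ l * s ^ (l + τ⁻¹ - 1) := by
    rw [intervalIntegral.integral_finsetSum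
      (fun l hl => (hint l (hF' l hl)).const_mul _), Finset.mul_sum]
    refine Finset.sum_congr rfl fun l hl => ?_
    have := hF' l hl
    have h2 : 0 < 1 + l * τ := by positivity
    rw [intervalIntegral.integral_const_mul, hval l this]
    have h3 : l + τ⁻¹ = (1 + l * τ) * τ⁻¹ := by field_simp; ring
    rw [h3]
    field_simp
  have h4 : ‖∫ s in (0 : ℝ)..1, ∑ l ∈ F, c l * t ^ l * s ^ (l + τ⁻¹ - 1)‖
      ≤ ∫ s in (0 : ℝ)..1, M * s ^ (0 + τ⁻¹ - 1) := by
    refine intervalIntegral.norm_integral_le_of_norm_le zero_le_one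
      (Eventually.of_forall fun s hs => ?_) ((hint 0 le_rfl).const_mul M)
    have : ∑ l ∈ F, c l * t ^ l * s ^ (l + τ⁻¹ - 1)
        = (∑ l ∈ F, c l * (s * t) ^ l) * s ^ (0 + τ⁻¹ - 1) := by
      rw [Finset.sum_mul]
      refine Finset.sum_congr rfl fun l _ => ?_
      rw [Real.mul_rpow hs.1.le ht.1.le, show l + τ⁻¹ - 1 = l + (0 + τ⁻¹ - 1) by ring,
        Real.rpow_add hs.1]
      ring
    rw [this, Real.norm_eq_abs, abs_mul, abs_of_nonneg (Real.rpow_nonneg hs.1.le _)]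
    exact mul_le_mul_of_nonneg_right
      (hM _ ⟨mul_pos hs.1 ht.1, mul_le_one₀ hs.2 ht.1.le ht.2⟩) (Real.rpow_nonneg hs.1.le _)
  rw [intervalIntegral.integral_const_mul, hval 0 le_rfl, Real.norm_eq_abs] at h4
  rw [h1, abs_mul, abs_of_pos ha, one_mul]
  calc τ⁻¹ * _ ≤ τ⁻¹ * (M * (0 + τ⁻¹)⁻¹) := mul_le_mul_of_nonneg_left h4 ha.le
    _ = M := by field_simp; ring

/-- The smoothing effect of the averaging operator: after it, the Euler operator `t d/dt` (the
multiplier `l`) is bounded, because `l / (1 + l τ) = τ⁻¹ (1 - 1 / (1 + l τ))`. -/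
theorem mul_inv_one_add {τ : ℝ} (hτ : 0 < τ) :
    MultiplierBound (Ici 0) (fun l => l * (1 + l * τ)⁻¹) (2 / τ) := by
  have h := ((const (Ici 0) 1).sub (inv_one_add hτ)).const_mul τ⁻¹
  rw [abs_one, abs_of_pos (inv_pos.2 hτ)] at h
  refine (h.congr fun l hl => ?_).mono (le_of_eq (by ring))
  have : 0 < 1 + l * τ := by have : 0 ≤ l := hl; positivity
  rw [show 1 - (1 + l * τ)⁻¹ = l * τ * (1 + l * τ)⁻¹ by
    rw [eq_comm, ← sub_eq_zero]; field_simp; ring]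
  field_simp

end MultiplierBound

/-! ### Interpolation on a dyadic block of exponents -/

/-- Newton interpolation of a bounded holomorphic function by polynomials in the dilation by `x`,
at the points `x ^ l`, `l ∈ S`; since these are real, taking real parts keeps the coefficients
real. One node `p` is split off by `f z = f p + (z - p) * dslope f p z`, where the Schwarz lemma
bounds `dslope f p` by `2 M / d`. -/
theorem exists_multiplierBound_interpolating {U : Set ℂ} (hU : IsOpen U) {d x : ℝ} (hd : 0 < d)
    (hx : x ∈ Ioc (0 : ℝ) 1) (S : Finset ℝ)
    (hS0 : ∀ l ∈ S, 0 ≤ l)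
    (hS : ∀ l ∈ S, Metric.ball (((x ^ l : ℝ) : ℂ)) d ⊆ U) :
    ∀ (f : ℂ → ℂ) (M : ℝ), DifferentiableOn ℂ f U → (∀ z ∈ U, ‖f z‖ ≤ M) → 0 ≤ M →
      ∃ N : ℝ → ℝ, MultiplierBound (Ici 0) N ((1 + 4 / d) ^ S.card * M) ∧
        ∀ l ∈ S, N l = (f ((x ^ l : ℝ) : ℂ)).re := by
  classical
  induction S using Finset.induction_on with
  | empty =>
    intro f M _ _ hM
    refine ⟨fun _ => 0, ?_, by simp⟩
    simpa using (MultiplierBound.const (Ici 0) 0).mono (by simpa using hM)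
  | insert μ S hμ ih =>
    intro f M hf hfM hM
    set p : ℂ := ((x ^ μ : ℝ) : ℂ) with hp
    have hball : Metric.ball p d ⊆ U := hS μ (Finset.mem_insert_self _ _)
    have hpU : p ∈ U := hball (Metric.mem_ball_self hd)
    have hdist : ∀ z ∈ U, ‖f z - f p‖ ≤ 2 * M := fun z hz =>
      (norm_sub_le _ _).trans (by linarith [hfM z hz, hfM p hpU])
    have hgM : ∀ z ∈ U, ‖dslope f p z‖ ≤ 2 * M / d := by
      intro z hz
      by_cases hzb : z ∈ Metric.ball p d
      · refine Complex.norm_dslope_le_div_of_mapsTo_ball (hf.mono hball) (fun w hw => ?_) hzb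
        rw [mem_closedBall_iff_norm]
        exact hdist w (hball hw)
      · have hzd : d ≤ ‖z - p‖ := by
          rw [Metric.mem_ball, not_lt, dist_eq_norm] at hzb
          exact hzb
        have hne : z ≠ p := by
          rintro rfl
          simp at hzd
          linarith
        rw [dslope_of_ne _ hne, slope_def_field, norm_div]
        exact div_le_div₀ (by positivity) (hdist z hz) hd hzd
    obtain ⟨N, hN, hNS⟩ := ih (fun l hl => hS0 l (Finset.mem_insert_of_mem hl))
      (fun l hl => hS l (Finset.mem_insert_of_mem hl)) (dslope f p) (2 * M / d)
      ((Complex.differentiableOn_dslope (hU.mem_nhds hpU)).2 hf) hgM (by positivity)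
    have hxμ0 : 0 ≤ x ^ μ := Real.rpow_nonneg hx.1.le _
    have hxμ1 : x ^ μ ≤ 1 :=
      Real.rpow_le_one hx.1.le hx.2 (hS0 μ (Finset.mem_insert_self _ _))
    refine ⟨fun l => (f p).re + (x ^ l - x ^ μ) * N l, ?_, ?_⟩
    · refine ((MultiplierBound.const _ (f p).re).add
        (((MultiplierBound.rpow _ hx).sub (MultiplierBound.const _ (x ^ μ))).mul hN)).mono ?_
      rw [Finset.card_insert_of_notMem hμ, abs_of_nonneg hxμ0]
      set K := (1 + 4 / d) ^ S.card with hK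
      have hK1 : 1 ≤ K := one_le_pow₀ (by have : 0 < 4 / d := by positivity
                                          linarith)
      have h1 : |(f p).re| ≤ M := (Complex.abs_re_le_norm _).trans (hfM p hpU)
      have h2 : (1 + x ^ μ) * (K * (2 * M / d)) ≤ 2 * (K * (2 * M / d)) :=
        mul_le_mul_of_nonneg_right (by linarith) (by positivity)
      have h3 : M ≤ K * M := le_mul_of_one_le_left hM hK1
      calc _ ≤ K * M + 2 * (K * (2 * M / d)) := by linarith
        _ = (1 + 4 / d) ^ (S.card + 1) * M := by rw [pow_succ, ← hK]; ring
    · intro l hl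
      rcases Finset.mem_insert.1 hl with rfl | hl
      · simp [hp]
      · have h := sub_smul_dslope f p ((x ^ l : ℝ) : ℂ)
        have h' := congrArg Complex.re h
        rw [hp, ← Complex.ofReal_sub, smul_eq_mul, Complex.re_ofReal_mul, ← hp] at h'
        simp only
        rw [hNS l hl, h', Complex.sub_re]
        ring

/-- On exponents in a dyadic block `[R, 2 R]`, the dilation by `4 ^ (-m / R)` agrees with an
operator that is small once `m` is a large multiple of the number of exponents, and that stays
bounded after multiplication by `l`.

With `x = 4 ^ (-1 / R)` the points `x ^ l` lie in `[1/16, 1/4]`. The operator is the averaging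
operator `1 / (1 + l τ)`, where `x = exp (-τ)`, applied to an interpolant of
`z ^ m * (1 - log z)`: at `z = x ^ l` the factor `1 - log z = 1 + l τ` cancels the averaging. -/
theorem exists_multiplierBound_eq_rpow_of_dyadic {R : ℝ} (hR : 0 < R) (m : ℕ) (S : Finset ℝ)
    (hS : ∀ l ∈ S, l ∈ Icc R (2 * R)) :
    ∃ N : ℝ → ℝ, MultiplierBound (Ici 0) N (10 * 2 ^ (8 * S.card) / 2 ^ m) ∧
      MultiplierBound (Ici 0) (fun l => l * N l) (20 * R * 2 ^ (8 * S.card) / 2 ^ m) ∧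
      ∀ l ∈ S, N l = ((4 : ℝ)⁻¹ ^ (m / R)) ^ l := by
  set x : ℝ := (4 : ℝ)⁻¹ ^ R⁻¹ with hx
  have hx0 : 0 < x := Real.rpow_pos_of_pos (by norm_num) _
  have hx1 : x ≤ 1 := Real.rpow_le_one (by norm_num) (by norm_num) (by positivity)
  -- `x ^ l = exp (-l τ)`
  set τ : ℝ := Real.log 4 / R with hτ
  have hlog4 : 1 ≤ Real.log 4 := by
    rw [Real.le_log_iff_exp_le (by norm_num)]
    linarith [Real.exp_one_lt_d9]
  have hτ0 : 0 < τ := by positivity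
  have hlogx : Real.log x = -τ := by
    rw [hx, Real.log_rpow (by norm_num), Real.log_inv, hτ]
    field_simp
  have hxl : ∀ l ∈ S, x ^ l ∈ Icc (1 / 16 : ℝ) (1 / 4) := by
    intro l hl
    have hl' := hS l hl
    rw [hx, ← Real.rpow_mul (by norm_num)]
    constructor
    · have : (1 / 16 : ℝ) = (4 : ℝ)⁻¹ ^ (2 : ℝ) := by norm_num
      rw [this]
      refine Real.rpow_le_rpow_of_exponent_ge (by norm_num) (by norm_num) ?_
      rw [inv_mul_le_iff₀ hR]; linarith [hl'.2]
    · have : (1 / 4 : ℝ) = (4 : ℝ)⁻¹ ^ (1 : ℝ) := by norm_num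
      rw [this]
      refine Real.rpow_le_rpow_of_exponent_ge (by norm_num) (by norm_num) ?_
      rw [le_inv_mul_iff₀ hR]; linarith [hl'.1]
  -- `z ^ m` is small on `U`, `log` is holomorphic and bounded there, and `U` contains the disc of
  -- radius `1 / 32` around each node
  set U : Set ℂ := {z | 1 / 32 < z.re} ∩ {z | ‖z‖ < 1 / 2} with hUdef
  have hU : IsOpen U := (isOpen_lt continuous_const Complex.continuous_re).inter
    (isOpen_lt continuous_norm continuous_const)
  have hball : ∀ l ∈ S, Metric.ball (((x ^ l : ℝ) : ℂ)) (1 / 32) ⊆ U := by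
    intro l hl z hz
    rw [mem_ball_iff_norm] at hz
    have hl' := hxl l hl
    have h1 := (Complex.abs_re_le_norm (z - ((x ^ l : ℝ) : ℂ))).trans_lt hz
    rw [Complex.sub_re, Complex.ofReal_re, abs_lt] at h1
    have h2 : ‖z‖ ≤ ‖z - ((x ^ l : ℝ) : ℂ)‖ + ‖((x ^ l : ℝ) : ℂ)‖ := by
      simpa using norm_add_le (z - ((x ^ l : ℝ) : ℂ)) ((x ^ l : ℝ) : ℂ)
    rw [Complex.norm_real, Real.norm_of_nonneg (by linarith [hl'.1])] at h2
    refine ⟨?_, ?_⟩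
    · rw [mem_ofPred_eq]; linarith [hl'.1]
    · rw [mem_ofPred_eq]; linarith [hl'.2]
  have hslit : ∀ z ∈ U, z ∈ Complex.slitPlane := fun z hz =>
    Or.inl (lt_trans (by norm_num) hz.1)
  set f : ℂ → ℂ := fun z => z ^ m * (1 - Complex.log z) with hf
  have hfd : DifferentiableOn ℂ f U := fun z hz =>
    ((differentiableAt_id.pow m).mul
      ((differentiableAt_const _).sub
        (Complex.differentiableAt_log (hslit z hz)))).differentiableWithinAt
  have hfM : ∀ z ∈ U, ‖f z‖ ≤ 10 / 2 ^ m := by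
    intro z hz
    have hz1 : 1 / 32 < ‖z‖ := lt_of_lt_of_le hz.1 (Complex.re_le_norm z)
    have hz2 : ‖z‖ < 1 / 2 := hz.2
    have hlog : ‖Complex.log z‖ ≤ 9 := by
      refine (Complex.norm_le_abs_re_add_abs_im _).trans ?_
      rw [Complex.log_re, Complex.log_im]
      have h1 := Complex.abs_arg_le_pi z
      have h2 : |Real.log ‖z‖| ≤ 5 := by
        rw [abs_le]
        constructor
        · have h3 : Real.log (1 / 32) ≤ Real.log ‖z‖ := Real.log_le_log (by norm_num) hz1.le
          have h4 : Real.log (1 / 32) = -(5 * Real.log 2) := by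
            rw [one_div, Real.log_inv, show (32 : ℝ) = 2 ^ 5 by norm_num, Real.log_pow]
            norm_num
          have := Real.log_two_lt_d9
          linarith
        · have := Real.log_nonpos (norm_nonneg z) (by linarith)
          linarith
      have := Real.pi_lt_four
      linarith
    rw [hf]
    simp only [norm_mul, norm_pow]
    have h1 : ‖1 - Complex.log z‖ ≤ 10 := by
      refine (norm_sub_le _ _).trans ?_
      rw [norm_one]; linarith
    have h2 : ‖z‖ ^ m ≤ (1 / 2) ^ m := pow_le_pow_left₀ (norm_nonneg _) hz2.le m
    calc ‖z‖ ^ m * ‖1 - Complex.log z‖ ≤ (1 / 2) ^ m * 10 :=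
          mul_le_mul h2 h1 (norm_nonneg _) (by positivity)
      _ = 10 / 2 ^ m := by rw [one_div, inv_pow]; field_simp
  have hS0 : ∀ l ∈ S, 0 ≤ l := fun l hl => hR.le.trans (hS l hl).1
  obtain ⟨P, hP, hPS⟩ := exists_multiplierBound_interpolating hU (by norm_num : (0 : ℝ) < 1 / 32)
    ⟨hx0, hx1⟩ S hS0 hball f (10 / 2 ^ m) hfd hfM (by positivity)
  have hP' : MultiplierBound (Ici 0) P (10 * 2 ^ (8 * S.card) / 2 ^ m) := by
    refine hP.mono ?_
    -- `1 + 4 / (1 / 32) = 129 ≤ 2 ^ 8`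
    have : (1 + 4 / (1 / 32 : ℝ)) ^ S.card ≤ 2 ^ (8 * S.card) := by
      rw [pow_mul]
      exact pow_le_pow_left₀ (by norm_num) (by norm_num) _
    calc _ ≤ 2 ^ (8 * S.card) * (10 / 2 ^ m : ℝ) :=
          mul_le_mul_of_nonneg_right this (by positivity)
      _ = _ := by ring
  refine ⟨fun l => (1 + l * τ)⁻¹ * P l, ?_, ?_, ?_⟩
  · simpa only [one_mul] using (MultiplierBound.inv_one_add hτ0).mul hP'
  · refine (((MultiplierBound.mul_inv_one_add hτ0).mul hP').congr
      (fun l _ => by ring)).mono ?_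
    have : 2 / τ ≤ 2 * R := by
      rw [div_le_iff₀ hτ0, hτ]
      have : 2 * R * (Real.log 4 / R) = 2 * Real.log 4 := by field_simp
      rw [this]; linarith
    calc _ ≤ 2 * R * (10 * 2 ^ (8 * S.card) / 2 ^ m) :=
          mul_le_mul_of_nonneg_right this (by positivity)
      _ = _ := by ring
  · intro l hl
    have hxl0 : 0 < x ^ l := Real.rpow_pos_of_pos hx0 _
    have hl0 := hS0 l hl
    have hne : 1 + l * τ ≠ 0 := by positivity
    have h1 : (f ((x ^ l : ℝ) : ℂ)).re = (x ^ l) ^ m * (1 + l * τ) := by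
      rw [hf]
      simp only
      rw [← Complex.ofReal_log hxl0.le, ← Complex.ofReal_pow, ← Complex.ofReal_one,
        ← Complex.ofReal_sub, ← Complex.ofReal_mul, Complex.ofReal_re, Real.log_rpow hx0, hlogx]
      ring
    have h4 : (0 : ℝ) ≤ 4⁻¹ := by norm_num
    simp only
    rw [hPS l hl, h1, mul_comm, mul_assoc, mul_inv_cancel₀ hne, mul_one, hx,
      ← Real.rpow_natCast, ← Real.rpow_mul h4, ← Real.rpow_mul h4, ← Real.rpow_mul h4]
    congr 1
    field_simp

/-! ### Damping of high exponents -/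

theorem MultiplierBound.of_finset {A : Set ℝ} {f : ℝ → ℝ} {C : ℝ}
    (h : ∀ F : Finset ℝ, (F : Set ℝ) ⊆ A → MultiplierBound F f C) : MultiplierBound A f C :=
  fun F hF => h F hF F Subset.rfl

/-- If each block `S b` has an operator `N b` of norm at most `δ b` that agrees on it with the
dilation by `x b`, then on the union of the blocks the dilation by `∏ x b` agrees with an operator
of norm at most `exp (∑ δ b) - 1`. Indeed `∏ (x b ^ l - N b l)` vanishes on all the blocks; its
expansion has the leading term `(∏ x b) ^ l`, and each other term contains some factor `N b l`.
This is why the bound survives multiplication by `l`. -/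
theorem exists_multiplierBound_eq_prod_rpow (I : Finset ℕ) (S : ℕ → Set ℝ) (x δ : ℕ → ℝ)
    (N : ℕ → ℝ → ℝ) (hx : ∀ b ∈ I, x b ∈ Ioc (0 : ℝ) 1) (hδ : ∀ b ∈ I, 0 ≤ δ b)
    (hN : ∀ b ∈ I, MultiplierBound (Ici 0) (N b) (δ b))
    (hN' : ∀ b ∈ I, MultiplierBound (Ici 0) (fun l => l * N b l) (δ b))
    (hNS : ∀ b ∈ I, ∀ l ∈ S b, N b l = x b ^ l) :
    ∃ P : ℝ → ℝ, MultiplierBound (Ici 0) P (Real.exp (∑ b ∈ I, δ b) - 1) ∧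
      MultiplierBound (Ici 0) (fun l => l * P l) (Real.exp (∑ b ∈ I, δ b) - 1) ∧
      ∀ b ∈ I, ∀ l ∈ S b, P l = (∏ b ∈ I, x b) ^ l := by
  classical
  induction I using Finset.induction_on with
  | empty =>
    refine ⟨fun _ => 0, ?_, ?_, by simp⟩ <;> simpa using MultiplierBound.const (Ici 0) 0
  | insert a I ha ih =>
    have hI : ∀ b ∈ I, b ∈ insert a I := fun b hb => Finset.mem_insert_of_mem hb
    have haI : a ∈ insert a I := Finset.mem_insert_self a I
    obtain ⟨P, hP, hP', hPS⟩ := ih (fun b hb => hx b (hI b hb)) (fun b hb => hδ b (hI b hb))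
      (fun b hb => hN b (hI b hb)) (fun b hb => hN' b (hI b hb)) (fun b hb => hNS b (hI b hb))
    set X := ∏ b ∈ I, x b with hX
    have hX0 : 0 < X := Finset.prod_pos fun b hb => (hx b (hI b hb)).1
    have hX1 : X ≤ 1 := Finset.prod_le_one (fun b hb => (hx b (hI b hb)).1.le)
      fun b hb => (hx b (hI b hb)).2
    set E := Real.exp (∑ b ∈ I, δ b) with hE
    have hE0 : 0 < E := Real.exp_pos _
    have hle : E - 1 + δ a + (E - 1) * δ a ≤ Real.exp (∑ b ∈ insert a I, δ b) - 1 := by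
      rw [Finset.sum_insert ha, Real.exp_add, ← hE]
      have := mul_le_mul_of_nonneg_right (Real.add_one_le_exp (δ a)) hE0.le
      linarith
    have hxa := MultiplierBound.rpow (Ici 0) (hx a haI)
    have hXb := MultiplierBound.rpow (Ici 0) ⟨hX0, hX1⟩
    have hfac : ∀ l : ℝ, (X * x a) ^ l = X ^ l * x a ^ l := fun l =>
      Real.mul_rpow hX0.le (hx a haI).1.le
    -- `X ^ l * x a ^ l` minus this multiplier is `(X ^ l - P l) * (x a ^ l - N a l)`
    refine ⟨fun l => x a ^ l * P l + X ^ l * N a l - P l * N a l, ?_, ?_, ?_⟩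
    · refine (((hxa.mul hP).add (hXb.mul (hN a haI))).sub (hP.mul (hN a haI))).mono ?_
      linarith
    · refine ((((hxa.mul hP').add (hXb.mul (hN' a haI))).sub (hP'.mul (hN a haI))).congr
        fun l _ => ?_).mono ?_
      · ring
      · linarith
    · intro b hb l hl
      rw [Finset.prod_insert ha, mul_comm (x a), ← hX, hfac]
      rcases Finset.mem_insert.1 hb with rfl | hb
      · simp only [hNS b haI l hl]
        ring
      · simp only [hPS b hb l hl]
        ring

theorem Summable.exists_sum_lt_of_le {g : ℕ → ℝ} (hg : Summable g) {η : ℝ} (hη : 0 < η) :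
    ∃ s : ℕ, ∀ G : Finset ℕ, (∀ i ∈ G, s ≤ i) → ∑ i ∈ G, g i < η := by
  obtain ⟨T, hT⟩ := summable_iff_vanishing_norm.1 hg η hη
  refine ⟨T.sup id + 1, fun G hG => (le_abs_self _).trans_lt (hT G ?_)⟩
  rw [Finset.disjoint_left]
  intro i hi hiT
  have h1 := hG i hi
  have h2 : i ≤ T.sup id := Finset.le_sup (f := id) hiT
  omega

/-- The dilation by `β` is small on a finite set of large exponents with small `∑ 1 / l`,
uniformly in the number of exponents. The block `[2 ^ b, 2 ^ (b + 1))`, with `n` exponents, is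
given the dilation by `4 ^ (-m / 2 ^ b)` with `m = 8 n + 2 b`: the summand `8 n` absorbs the
interpolation constants, the summand `2 b` makes the bounds summable, and the total dilation stays
above `β`. -/
theorem multiplierBound_of_sum_inv_le {β η : ℝ} (hβ : β ∈ Ioo (0 : ℝ) 1) {b₀ : ℕ}
    (hη : ∀ G : Finset ℕ, (∀ b ∈ G, b₀ ≤ b) → ∑ b ∈ G, 2 * b * (1 / 2 : ℝ) ^ b ≤ η)
    {κ : ℝ} (hκ : ∀ G : Finset ℕ, (∀ b ∈ G, b₀ ≤ b) → ∑ b ∈ G, 20 * (1 / 2 : ℝ) ^ b ≤ κ)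
    (F : Finset ℝ) (hF : ∀ l ∈ F, (2 : ℝ) ^ b₀ ≤ l)
    (hsum : 16 * ∑ l ∈ F, 1 / l + η ≤ Real.log β⁻¹ / Real.log 4) :
    MultiplierBound F (fun l => β ^ l) (Real.exp κ - 1) ∧
      MultiplierBound F (fun l => l * β ^ l) (Real.exp κ - 1) := by
  classical
  -- `l` belongs to the block `[2 ^ e l, 2 ^ (e l + 1))`
  set e : ℝ → ℕ := fun l => Nat.log 2 ⌊l⌋₊ with he
  have hF1 : ∀ l ∈ F, 1 ≤ l := fun l hl => (one_le_pow₀ one_le_two).trans (hF l hl)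
  have he1 : ∀ l ∈ F, (2 : ℝ) ^ e l ≤ l := by
    intro l hl
    have h1 : ⌊l⌋₊ ≠ 0 := (Nat.floor_pos.2 (hF1 l hl)).ne'
    have h2 : ((2 ^ e l : ℕ) : ℝ) ≤ (⌊l⌋₊ : ℝ) := by exact_mod_cast Nat.pow_log_le_self 2 h1
    push_cast at h2
    exact h2.trans (Nat.floor_le (by linarith [hF1 l hl]))
  have he2 : ∀ l ∈ F, l ≤ 2 * (2 : ℝ) ^ e l := by
    intro l hl
    have h1 : ⌊l⌋₊ + 1 ≤ 2 ^ (e l + 1) := Nat.lt_pow_succ_log_self one_lt_two ⌊l⌋₊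
    have h2 : ((⌊l⌋₊ + 1 : ℕ) : ℝ) ≤ ((2 ^ (e l + 1) : ℕ) : ℝ) := by exact_mod_cast h1
    push_cast at h2
    rw [pow_succ] at h2
    linarith [Nat.lt_floor_add_one l]
  have he0 : ∀ l ∈ F, b₀ ≤ e l := by
    intro l hl
    refine Nat.le_log_of_pow_le one_lt_two (Nat.le_floor ?_)
    push_cast
    exact hF l hl
  set S : ℕ → Finset ℝ := fun b => F.filter (fun l => e l = b) with hS
  set I := F.image e with hI
  have hIb : ∀ b ∈ I, b₀ ≤ b := by
    intro b hb
    obtain ⟨l, hl, rfl⟩ := Finset.mem_image.1 hb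
    exact he0 l hl
  set m : ℕ → ℕ := fun b => 8 * (S b).card + 2 * b with hm
  have hblock : ∀ b, ∃ N : ℝ → ℝ,
      MultiplierBound (Ici 0) N (20 * (1 / 2 : ℝ) ^ b) ∧
      MultiplierBound (Ici 0) (fun l => l * N l) (20 * (1 / 2 : ℝ) ^ b) ∧
      ∀ l ∈ S b, N l = ((4 : ℝ)⁻¹ ^ (m b / (2 : ℝ) ^ b)) ^ l := by
    intro b
    obtain ⟨N, h1, h2, h3⟩ := exists_multiplierBound_eq_rpow_of_dyadic
      (R := (2 : ℝ) ^ b) (by positivity) (m b) (S b) (fun l hl => by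
        obtain ⟨hl, hb⟩ := Finset.mem_filter.1 hl
        rw [← hb]
        exact ⟨he1 l hl, he2 l hl⟩)
    have hb1 : (1 : ℝ) ≤ 2 ^ b := one_le_pow₀ one_le_two
    have h4 : 20 * (2 : ℝ) ^ b * 2 ^ (8 * (S b).card) / 2 ^ m b = 20 * (1 / 2 : ℝ) ^ b := by
      rw [hm]
      simp only [pow_add, two_mul, one_div, inv_pow]
      field_simp
    refine ⟨N, h1.mono ?_, h4 ▸ h2, h3⟩
    rw [← h4]
    gcongr
    nlinarith
  choose N hN hN' hNS using hblock
  have h4pos : (0 : ℝ) < 4⁻¹ := by norm_num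
  obtain ⟨P, hP, hP', hPS⟩ := exists_multiplierBound_eq_prod_rpow I (fun b => (S b : Set ℝ))
    (fun b => (4 : ℝ)⁻¹ ^ (m b / (2 : ℝ) ^ b)) (fun b => 20 * (1 / 2 : ℝ) ^ b) N
    (fun b _ => ⟨Real.rpow_pos_of_pos h4pos _,
      Real.rpow_le_one h4pos.le (by norm_num) (by positivity)⟩)
    (fun b _ => by positivity) (fun b _ => hN b) (fun b _ => hN' b)
    (fun b _ l hl => hNS b l hl)
  set X := ∏ b ∈ I, (4 : ℝ)⁻¹ ^ (m b / (2 : ℝ) ^ b) with hX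
  have hX' : X = (4 : ℝ)⁻¹ ^ (∑ b ∈ I, m b / (2 : ℝ) ^ b) := by
    rw [hX, Real.rpow_sum_of_pos h4pos]
  have hX0 : 0 < X := hX' ▸ Real.rpow_pos_of_pos h4pos _
  have hcount : ∑ b ∈ I, ((S b).card : ℝ) / 2 ^ b ≤ 2 * ∑ l ∈ F, 1 / l := by
    rw [← Finset.sum_fiberwise_of_maps_to (s := F) (t := I) (g := e)
      (fun l hl => Finset.mem_image_of_mem e hl), Finset.mul_sum]
    refine Finset.sum_le_sum fun b _ => ?_
    rw [div_eq_mul_inv, ← nsmul_eq_mul, ← Finset.sum_const, Finset.mul_sum]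
    refine Finset.sum_le_sum fun l hl => ?_
    obtain ⟨hl, hb⟩ := Finset.mem_filter.1 hl
    have h1 := he2 l hl
    rw [hb] at h1
    have h2 : 0 < l := by linarith [hF1 l hl]
    rw [inv_le_iff_one_le_mul₀ (by positivity), mul_one_div, div_mul_eq_mul_div, le_div_iff₀ h2]
    linarith
  have hexp : ∑ b ∈ I, m b / (2 : ℝ) ^ b ≤ Real.log β⁻¹ / Real.log 4 := by
    refine le_trans ?_ hsum
    have h1 : ∑ b ∈ I, m b / (2 : ℝ) ^ b
        = 8 * ∑ b ∈ I, ((S b).card : ℝ) / 2 ^ b + ∑ b ∈ I, 2 * b * (1 / 2 : ℝ) ^ b := by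
      rw [Finset.mul_sum, ← Finset.sum_add_distrib]
      refine Finset.sum_congr rfl fun b _ => ?_
      rw [hm, one_div, inv_pow]
      push_cast
      field_simp
    rw [h1]
    linarith [hη I hIb]
  have hβX : β ≤ X := by
    have hlog4 : 0 < Real.log 4 := Real.log_pos (by norm_num)
    rw [← Real.log_le_log_iff hβ.1 hX0, hX', Real.log_rpow h4pos, Real.log_inv]
    rw [Real.log_inv, le_div_iff₀ hlog4] at hexp
    linarith
  -- the remaining dilation, from `X` down to `β`, has norm at most `1`
  have hy := MultiplierBound.rpow (Ici 0) (x := β / X)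
    ⟨div_pos hβ.1 hX0, (div_le_one hX0).2 hβX⟩
  have hFsub : (F : Set ℝ) ⊆ Ici 0 := fun l hl => zero_le_one.trans (hF1 l hl)
  have hval : ∀ l ∈ (F : Set ℝ), (β / X) ^ l * P l = β ^ l := by
    intro l hl
    rw [hPS (e l) (Finset.mem_image_of_mem e hl) l (Finset.mem_filter.2 ⟨hl, rfl⟩),
      ← Real.mul_rpow (div_pos hβ.1 hX0).le hX0.le, div_mul_cancel₀ _ hX0.ne']
  have hle : 1 * (Real.exp (∑ b ∈ I, 20 * (1 / 2 : ℝ) ^ b) - 1) ≤ Real.exp κ - 1 := by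
    rw [one_mul]
    exact sub_le_sub_right (Real.exp_le_exp.2 (hκ I hIb)) _
  exact ⟨(((hy.mul hP).mono_set hFsub).congr hval).mono hle,
    (((hy.mul hP').mono_set hFsub).congr fun l hl => by rw [← hval l hl]; ring).mono hle⟩

namespace MuntzSequence

variable (Λ : MuntzSequence)

theorem summable_one_div : Summable fun i => 1 / Λ i :=
  (summable_nat_add_iff 1).1 Λ.summable'

theorem tendsto_atTop : Tendsto Λ atTop atTop := by
  have h := Λ.summable_one_div.tendsto_atTop_zero
  have hpos : ∀ᶠ i in atTop, 0 < 1 / Λ i := by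
    filter_upwards [eventually_gt_atTop 0] with i hi
    have := Λ.strictMono' hi
    rw [Λ.zero'] at this
    exact one_div_pos.2 this
  have := (tendsto_nhdsWithin_iff.2 ⟨h, hpos⟩).inv_tendsto_nhdsGT_zero
  refine this.congr fun i => ?_
  simp

/-- High exponents are damped: on the span of `t ^ Λ i`, `i ≥ s`, the operators `p ↦ p (β t)` and
`p ↦ β t p' (β t)` have norm at most `ε` when `s` is large. -/
theorem exists_tail_multiplierBound {β ε : ℝ} (hβ : β ∈ Ioo (0 : ℝ) 1) (hε : 0 < ε) :
    ∃ s : ℕ, MultiplierBound (Λ '' Ici s) (fun l => β ^ l) ε ∧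
      MultiplierBound (Λ '' Ici s) (fun l => l * β ^ l) ε := by
  classical
  set η : ℝ := Real.log β⁻¹ / Real.log 4 / 2 with hη
  have hη0 : 0 < η := by
    have h1 : 0 < Real.log β⁻¹ := Real.log_pos ((one_lt_inv₀ hβ.1).2 hβ.2)
    have h2 : 0 < Real.log 4 := Real.log_pos (by norm_num)
    positivity
  set κ : ℝ := Real.log (1 + ε) with hκ
  have hκ0 : 0 < κ := Real.log_pos (by linarith)
  have hs1 : Summable fun b : ℕ => 2 * b * (1 / 2 : ℝ) ^ b := by
    have := (summable_pow_mul_geometric_of_norm_lt_one 1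
      (r := (1 / 2 : ℝ)) (by norm_num)).mul_left 2
    simpa [mul_assoc] using this
  have hs2 : Summable fun b : ℕ => 20 * (1 / 2 : ℝ) ^ b := summable_geometric_two.mul_left 20
  obtain ⟨b₁, hb₁⟩ := hs1.exists_sum_lt_of_le hη0
  obtain ⟨b₂, hb₂⟩ := hs2.exists_sum_lt_of_le hκ0
  obtain ⟨s₁, hs₁⟩ := Λ.summable_one_div.exists_sum_lt_of_le
    (div_pos hη0 (by norm_num : (0 : ℝ) < 16))
  obtain ⟨s₂, hs₂⟩ := eventually_atTop.1 (Λ.tendsto_atTop.eventually_ge_atTop ((2 : ℝ) ^ max b₁ b₂))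
  have main : ∀ F : Finset ℝ, (F : Set ℝ) ⊆ Λ '' Ici (max s₁ s₂) →
      MultiplierBound F (fun l => β ^ l) ε ∧ MultiplierBound F (fun l => l * β ^ l) ε := by
    intro F hF
    obtain ⟨G, hG, rfl⟩ := Finset.subset_set_image_iff.1 hF
    have hG' : ∀ i ∈ G, max s₁ s₂ ≤ i := fun i hi => hG hi
    have := multiplierBound_of_sum_inv_le hβ (b₀ := max b₁ b₂) (η := η) (κ := κ)
      (fun H hH => (hb₁ H fun b hb => (le_max_left _ _).trans (hH b hb)).le)
      (fun H hH => (hb₂ H fun b hb => (le_max_right _ _).trans (hH b hb)).le)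
      (G.image Λ) (fun l hl => by
        obtain ⟨i, hi, rfl⟩ := Finset.mem_image.1 hl
        exact hs₂ i ((le_max_right _ _).trans (hG' i hi)))
      (by
        rw [Finset.sum_image fun i _ j _ hij => Λ.strictMono'.injective hij]
        have := hs₁ G fun i hi => (le_max_left _ _).trans (hG' i hi)
        linarith)
    rwa [hκ, Real.exp_log (by linarith), add_sub_cancel_left] at this
  exact ⟨max s₁ s₂, .of_finset fun F hF => (main F hF).1, .of_finset fun F hF => (main F hF).2⟩

end MuntzSequence

/-! ### Coefficient functionals and the Bernstein inequality -/

/-- If the dilation by `β` has norm at most `ε < β ^ μ` on the span of the exponents in `A`, the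
coefficient of `t ^ μ` is bounded after adjoining `μ` to `A`: comparing the values at `β` of both
sides of `p = c t ^ μ + g`, where `‖g‖ ≤ ‖p‖ + |c|`, gives `|c| β ^ μ ≤ ‖p‖ + ε (‖p‖ + |c|)`. -/
theorem multiplierBound_indicator_insert {A : Set ℝ} {β ε μ : ℝ} (hβ : β ∈ Ioc (0 : ℝ) 1)
    (hA : MultiplierBound A (fun l => β ^ l) ε) (hε : 0 ≤ ε) (hεμ : ε < β ^ μ) (hμ : 0 ≤ μ) :
    MultiplierBound (insert μ A) (({μ} : Set ℝ).indicator 1) ((1 + ε) / (β ^ μ - ε)) := by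
  classical
  intro F hF c M hM t ht
  have hM0 := MultiplierBound.nonneg_of_bound hM
  have hsub : 0 < β ^ μ - ε := by linarith
  have htμ : ∀ t ∈ Ioc (0 : ℝ) 1, |c μ * t ^ μ| ≤ |c μ| := fun t ht => by
    rw [abs_mul, abs_of_nonneg (Real.rpow_nonneg ht.1.le μ)]
    exact mul_le_of_le_one_right (abs_nonneg _) (Real.rpow_le_one ht.1.le ht.2 hμ)
  by_cases hμF : μ ∈ F
  · have hsplit : ∀ t : ℝ, ∑ l ∈ F, c l * t ^ l = c μ * t ^ μ + ∑ l ∈ F.erase μ, c l * t ^ l :=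
      fun t => (Finset.add_sum_erase F (fun l => c l * t ^ l) hμF).symm
    have hg : ∀ t ∈ Ioc (0 : ℝ) 1, |∑ l ∈ F.erase μ, c l * t ^ l| ≤ M + |c μ| := by
      intro t ht
      have h1 := hM t ht
      have h2 : ∑ l ∈ F.erase μ, c l * t ^ l = ∑ l ∈ F, c l * t ^ l - c μ * t ^ μ := by
        rw [hsplit t]; ring
      rw [h2]
      exact (abs_sub _ _).trans (add_le_add h1 (htμ t ht))
    have hsubA : ((F.erase μ : Finset ℝ) : Set ℝ) ⊆ A := by
      intro l hl
      have hl' := Finset.mem_erase.1 hl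
      exact (hF hl'.2).resolve_left hl'.1
    have h1 := hA _ hsubA c _ hg 1 ⟨one_pos, le_rfl⟩
    simp only [Real.one_rpow, mul_one] at h1
    have h2 : |c μ| * β ^ μ ≤ M + ε * (M + |c μ|) := by
      have h3 : c μ * β ^ μ = ∑ l ∈ F, c l * β ^ l - ∑ l ∈ F.erase μ, c l * β ^ l := by
        rw [hsplit β]; ring
      rw [← abs_of_nonneg (Real.rpow_nonneg hβ.1.le μ), ← abs_mul, h3]
      exact (abs_sub _ _).trans (add_le_add (hM β hβ) h1)
    have h4 : ∑ l ∈ F, c l * ({μ} : Set ℝ).indicator 1 l * t ^ l = c μ * t ^ μ := by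
      rw [Finset.sum_eq_single_of_mem μ hμF]
      · simp
      · intro l _ hl
        simp [hl]
    rw [h4]
    refine (htμ t ht).trans ?_
    rw [div_mul_eq_mul_div, le_div_iff₀ hsub]
    linarith
  · have h4 : ∑ l ∈ F, c l * ({μ} : Set ℝ).indicator 1 l * t ^ l = 0 := by
      refine Finset.sum_eq_zero fun l hl => ?_
      have : l ≠ μ := fun h => hμF (h ▸ hl)
      simp [this]
    rw [h4, abs_zero]
    positivity

/-- Boundedness of the coefficient of `t ^ μ` persists when one more exponent `ν` is adjoined: the
operator with multiplier `β ^ l - β ^ ν` removes `t ^ ν` and multiplies the coefficient of `t ^ μ`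
by a nonzero constant. -/
theorem MultiplierBound.indicator_insert {A : Set ℝ} {β μ ν C : ℝ} (hβ : β ∈ Ioo (0 : ℝ) 1)
    (hA : MultiplierBound A (({μ} : Set ℝ).indicator 1) C) (hμν : μ ≠ ν) :
    ∃ D, MultiplierBound (insert ν A) (({μ} : Set ℝ).indicator 1) D := by
  have hne : β ^ μ - β ^ ν ≠ 0 := by
    rw [sub_ne_zero]
    intro h
    rw [Real.rpow_right_inj hβ.1 hβ.2.ne] at h
    exact hμν h
  have h1 := (((MultiplierBound.rpow (insert ν A) ⟨hβ.1, hβ.2.le⟩).sub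
    (MultiplierBound.const _ (β ^ ν))).const_mul (β ^ μ - β ^ ν)⁻¹)
  refine ⟨_, (h1.mul_of_support (B := A) (fun l hl hlA => ?_) hA).congr fun l _ => ?_⟩
  · rcases hl with rfl | hl
    · simp
    · exact absurd hl hlA
  · by_cases hl : l = μ
    · subst hl
      simp [hne]
    · simp [hl]

namespace MuntzSequence

variable (Λ : MuntzSequence)

/-- The coefficient functionals are bounded on `Π(Λ)`. -/
theorem exists_multiplierBound_indicator (i : ℕ) :
    ∃ C, MultiplierBound (range Λ) (({Λ i} : Set ℝ).indicator 1) C := by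
  have hβ : (1 / 2 : ℝ) ∈ Ioo (0 : ℝ) 1 := by norm_num
  have hpos : 0 < (1 / 2 : ℝ) ^ Λ i := Real.rpow_pos_of_pos hβ.1 _
  obtain ⟨s, hs, -⟩ := Λ.exists_tail_multiplierBound hβ (half_pos hpos)
  have key : ∀ k : ℕ, ∃ C, MultiplierBound (insert (Λ i) (Λ '' Ici s) ∪ Λ '' Iio k)
      (({Λ i} : Set ℝ).indicator 1) C := by
    intro k
    induction k with
    | zero =>
      refine ⟨_, (multiplierBound_indicator_insert ⟨hβ.1, hβ.2.le⟩ hs (half_pos hpos).le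
        (half_lt_self hpos) (Λ.nonneg i)).mono_set ?_⟩
      simp
    | succ k ih =>
      obtain ⟨C, hC⟩ := ih
      have hset : insert (Λ i) (Λ '' Ici s) ∪ Λ '' Iio (k + 1)
          = insert (Λ k) (insert (Λ i) (Λ '' Ici s) ∪ Λ '' Iio k) := by
        have hIio : Iio (k + 1) = insert k (Iio k) := by
          ext j
          simp only [mem_Iio, mem_insert_iff]
          omega
        rw [← Set.union_insert, hIio, image_insert_eq]
      rw [hset]
      by_cases hik : i = k
      · subst hik
        exact ⟨C, hC.mono_set (insert_subset (Or.inl (mem_insert _ _)) Subset.rfl)⟩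
      · exact hC.indicator_insert hβ (Λ.strictMono'.injective.ne hik)
  obtain ⟨C, hC⟩ := key s
  refine ⟨C, hC.mono_set ?_⟩
  rintro _ ⟨j, rfl⟩
  rcases lt_or_ge j s with h | h
  · exact Or.inr ⟨j, h, rfl⟩
  · exact Or.inl (Or.inr ⟨j, h, rfl⟩)

/-- The multiplier `l * x ^ (l - 1)` of the functional `p ↦ p' x` is bounded uniformly for
`x ∈ (0, b]`. The finitely many low exponents are handled by the coefficient functionals. On the
high exponents `x = β * β ^ k * y` with `y ∈ (β, 1]`, and the dilation by `β` has norm at most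
`β`; the gain `β ^ (k + 1)` outweighs the factor `x⁻¹`. -/
theorem exists_multiplierBound_deriv (h1 : 1 ≤ Λ 1) {b : ℝ} (hb : b < 1) :
    ∃ K : ℝ, 0 < K ∧ ∀ x ∈ Ioc 0 b,
      MultiplierBound (range Λ) (fun l => l * x ^ (l - 1)) K := by
  set β := max b (1 / 2)
  have hβ : β ∈ Ioo (0 : ℝ) 1 :=
    ⟨lt_of_lt_of_le (by norm_num) (le_max_right _ _), max_lt hb (by norm_num)⟩
  obtain ⟨s, hs, hs'⟩ := Λ.exists_tail_multiplierBound hβ hβ.1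
  choose C hC using Λ.exists_multiplierBound_indicator
  have hhigh := (MultiplierBound.const (range Λ) 1).sub
    (MultiplierBound.sum (Finset.range s) _ C fun i _ => hC i)
  -- `hhigh` bounds the projection onto the span of the high exponents
  set D := |(1 : ℝ)| + ∑ i ∈ Finset.range s, C i
  set E := ∑ i ∈ Finset.range s, Λ i * C i
  refine ⟨max (E + D * β⁻¹) 1, lt_max_of_lt_right one_pos, fun x hx => ?_⟩
  have hind : ∀ i j, ({Λ i} : Set ℝ).indicator (1 : ℝ → ℝ) (Λ j) = if j = i then 1 else 0 := by
    intro i j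
    by_cases h : j = i
    · simp [h]
    · simp [h, Λ.strictMono'.injective.ne h]
  have hx1 : x ≤ 1 := hx.2.trans hb.le
  have hlow : MultiplierBound (range Λ)
      (fun l => ∑ i ∈ Finset.range s, (Λ i * x ^ (Λ i - 1)) * ({Λ i} : Set ℝ).indicator 1 l) E := by
    refine .sum _ _ _ fun i _ => ((hC i).const_mul (Λ i * x ^ (Λ i - 1))).congr
      (fun l _ => rfl) |>.mono ?_
    have hCi : 0 ≤ C i := by
      have := hC i ∅ (by simp) 0 1 (by simp) 1 ⟨one_pos, le_rfl⟩
      simpa using this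
    refine mul_le_mul_of_nonneg_right ?_ hCi
    rw [abs_of_nonneg (mul_nonneg (Λ.nonneg i) (Real.rpow_nonneg hx.1.le _))]
    -- for `i = 0` the exponent of `x` is negative, but the factor `Λ 0 = 0` removes the term
    rcases Nat.eq_zero_or_pos i with rfl | hi
    · simp [Λ.zero']
    · exact mul_le_of_le_one_right (Λ.nonneg i) (Real.rpow_le_one hx.1.le hx1
        (by linarith [Λ.strictMono'.monotone hi]))
  obtain ⟨k, hk1, hk2⟩ := exists_nat_pow_near_of_lt_one (x := x / β) (div_pos hx.1 hβ.1)
    ((div_le_one hβ.1).2 (hx.2.trans (le_max_left _ _))) hβ.1 hβ.2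
  set y := x / β / β ^ k with hy
  have hβk : 0 < β ^ k := pow_pos hβ.1 k
  have hy0 : β < y := by rw [hy, lt_div_iff₀ hβk, mul_comm, ← pow_succ]; exact hk1
  have hy1 : y ≤ 1 := (div_le_one hβk).2 hk2
  have hypos : 0 < y := hβ.1.trans hy0
  have hxy : x = β * β ^ k * y := by
    have := hβ.1.ne'
    rw [hy]; field_simp
  have htail : MultiplierBound (Λ '' Ici s) (fun l => l * x ^ (l - 1)) β⁻¹ := by
    refine (((hs'.mul (hs.pow k)).mul (MultiplierBound.rpow _ ⟨hypos, hy1⟩)).const_mul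
      x⁻¹).congr (fun l _ => ?_) |>.mono ?_
    · have hpow : (β ^ k) ^ l = (β ^ l) ^ k := by
        rw [← Real.rpow_natCast, ← Real.rpow_mul hβ.1.le, mul_comm, Real.rpow_mul hβ.1.le,
          Real.rpow_natCast]
      have hxl : x ^ l = β ^ l * (β ^ l) ^ k * y ^ l := by
        rw [hxy, Real.mul_rpow (mul_pos hβ.1 hβk).le hypos.le, Real.mul_rpow hβ.1.le hβk.le, hpow]
      rw [Real.rpow_sub_one hx.1.ne', hxl]
      ring
    · rw [abs_of_pos (inv_pos.2 hx.1), hxy, mul_one, ← div_eq_inv_mul,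
        div_mul_cancel_left₀ (mul_pos hβ.1 hβk).ne']
      exact inv_anti₀ hβ.1 hy0.le
  refine ((hlow.add (hhigh.mul_of_support (B := Λ '' Ici s) ?_ htail)).congr ?_).mono
    (le_max_left _ _)
  · rintro _ ⟨j, rfl⟩ hj
    have hjs : j < s := by
      by_contra h
      exact hj ⟨j, not_lt.1 h, rfl⟩
    simp [hind, hjs]
  · rintro _ ⟨j, rfl⟩
    simp only [hind, mul_ite, mul_one, mul_zero, Finset.sum_ite_eq, Finset.mem_range]
    split_ifs <;> simp

theorem exists_eq_sum_of_mem_polynomials {p : C(unitInterval, ℝ)} (hp : p ∈ Λ.polynomials) :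
    ∃ (F : Finset ℝ) (c : ℝ → ℝ), (F : Set ℝ) ⊆ range Λ ∧
      ∀ t : unitInterval, p t = ∑ l ∈ F, c l * (t : ℝ) ^ l := by
  classical
  obtain ⟨v, rfl⟩ := Finsupp.mem_span_range_iff_exists_finsupp.1 hp
  have hinj := Λ.strictMono'.injective
  refine ⟨v.support.image Λ, fun l => v (Function.invFun Λ l), ?_, fun t => ?_⟩
  · rw [Finset.coe_image]
    exact image_subset_range _ _
  · rw [Finset.sum_image fun i _ j _ hij => hinj hij, Finsupp.sum, ContinuousMap.sum_apply]
    refine Finset.sum_congr rfl fun i _ => ?_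
    have hi := Function.leftInverse_invFun hinj i
    simp only [hi]
    rfl

/-- The bounded Bernstein inequality for Müntz polynomials, without any gap condition on `Λ`. -/
theorem exists_isBernsteinConstant (h1 : 1 ≤ Λ 1) {b : ℝ} (hb : b < 1) :
    ∃ K : ℝ, 0 < K ∧ Λ.IsBernsteinConstant b K := by
  obtain ⟨K, hK, hKb⟩ := Λ.exists_multiplierBound_deriv h1 (b := max b (1 / 2))
    (max_lt hb (by norm_num))
  refine ⟨K, hK, fun p hp t ht => ?_⟩
  obtain ⟨F, c, hF, hpF⟩ := Λ.exists_eq_sum_of_mem_polynomials hp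
  have hexp : ∀ l ∈ F, l = 0 ∨ 1 ≤ l := by
    intro l hl
    obtain ⟨i, rfl⟩ := hF hl
    rcases Nat.eq_zero_or_pos i with rfl | hi
    · exact Or.inl Λ.zero'
    · exact Or.inr (h1.trans (Λ.strictMono'.monotone hi))
  set q : ℝ → ℝ := fun x => ∑ l ∈ F, c l * (l * x ^ (l - 1)) with hq
  have hqM : ∀ x ∈ Ioc 0 (max b (1 / 2)), |q x| ≤ K * ‖p‖ := by
    intro x hx
    have := hKb x hx F hF c ‖p‖ (fun t ht => by
      rw [← hpF ⟨t, ht.1.le, ht.2⟩]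
      exact p.norm_coe_le_norm _) 1 ⟨one_pos, le_rfl⟩
    simpa only [Real.one_rpow, mul_one] using this
  have hqc : Continuous q := by
    refine continuous_finsetSum _ fun l hl => continuous_const.mul ?_
    rcases hexp l hl with rfl | hl1
    · simpa using continuous_const
    · exact continuous_const.mul (continuous_id.rpow_const fun _ => Or.inr (by linarith))
  have hderiv : HasDerivAt (fun x : ℝ => ∑ l ∈ F, c l * x ^ l) (q t) t := by
    refine HasDerivAt.fun_sum fun l hl => HasDerivAt.const_mul _ ?_
    rcases hexp l hl with rfl | hl1
    · simpa using hasDerivAt_const t (1 : ℝ)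
    · exact Real.hasDerivAt_rpow_const (Or.inr hl1)
  have heq : ∀ x ∈ Icc (0 : ℝ) 1, IccExtend (zero_le_one' ℝ) p x = ∑ l ∈ F, c l * x ^ l := by
    intro x hx
    rw [IccExtend_of_mem _ _ hx]
    exact hpF ⟨x, hx⟩
  refine ⟨q t, hderiv.hasDerivWithinAt.congr heq (heq t ⟨ht.1, ht.2.trans hb.le⟩), ?_⟩
  -- the bound on `(0, b]` extends to the endpoint `0` by continuity of the derivative
  have hclosure : t ∈ closure (Ioc 0 (max b (1 / 2))) := by
    rw [closure_Ioc (ne_of_lt (lt_max_of_lt_right (by norm_num)))]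
    exact ⟨ht.1, ht.2.trans (le_max_left _ _)⟩
  exact closure_minimal (t := {x | |q x| ≤ K * ‖p‖}) hqM
    (isClosed_le hqc.abs continuous_const) hclosure

end MuntzSequence

/-! ### Sampling operators -/

theorem exists_le_lt_succ {α : Type*} [LinearOrder α] {u : ℕ → α} {x : α} (h0 : u 0 ≤ x)
    (h : ∃ N, x < u N) : ∃ j, u j ≤ x ∧ x < u (j + 1) := by
  classical
  have hpos : Nat.find h ≠ 0 := fun h' => absurd (h' ▸ Nat.find_spec h) (not_lt.2 h0)
  obtain ⟨j, hj⟩ := Nat.exists_eq_succ_of_ne_zero hpos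
  refine ⟨j, not_lt.1 (Nat.find_min h (by omega)), ?_⟩
  have := Nat.find_spec h
  rwa [hj] at this

/-- A strictly increasing sequence can be refined so that the steps between `a i` and `a (i + 1)`
are at most `δ i`: each gap is divided into equal parts. -/
theorem exists_refinement {a δ : ℕ → ℝ} (ha : StrictMono a) (hδ : ∀ i, 0 < δ i) :
    ∃ (s : ℕ → ℝ) (n : ℕ → ℕ), StrictMono s ∧ StrictMono n ∧ n 0 = 0 ∧ (∀ i, s (n i) = a i) ∧
      ∀ i j, n i ≤ j → j < n (i + 1) → s (j + 1) - s j ≤ δ i := by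
  have hm : ∀ i, ∃ m : ℕ, 0 < m ∧ (a (i + 1) - a i) / m ≤ δ i := by
    intro i
    have hgap : 0 < a (i + 1) - a i := sub_pos.2 (ha i.lt_succ_self)
    obtain ⟨m, hm⟩ := exists_nat_ge ((a (i + 1) - a i) / δ i)
    have hm0 : (0 : ℝ) < m := (div_pos hgap (hδ i)).trans_le hm
    refine ⟨m, by exact_mod_cast hm0, ?_⟩
    rw [div_le_iff₀ hm0]
    rwa [div_le_iff₀ (hδ i), mul_comm] at hm
  choose m hm0 hmδ using hm
  set n : ℕ → ℕ := fun i => ∑ j ∈ Finset.range i, m j with hn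
  have hn0 : n 0 = 0 := by simp [hn]
  have hnsucc : ∀ i, n (i + 1) = n i + m i := fun i => Finset.sum_range_succ m i
  have hnmono : StrictMono n := strictMono_nat_of_lt_succ fun i => by
    have := hm0 i
    rw [hnsucc]; omega
  have hblock : ∀ j, ∃ i, n i ≤ j ∧ j < n (i + 1) := fun j =>
    exists_le_lt_succ (hn0 ▸ j.zero_le) ⟨j + 1, hnmono.id_le (j + 1)⟩
  choose e he1 he2 using hblock
  have heq : ∀ i j, n i ≤ j → j < n (i + 1) → e j = i := by
    intro i j h1 h2
    have h3 := hnmono.lt_iff_lt.1 ((he1 j).trans_lt h2)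
    have h4 := hnmono.lt_iff_lt.1 (h1.trans_lt (he2 j))
    omega
  -- the length of the parts of the gap from `a i` to `a (i + 1)`
  set r : ℕ → ℝ := fun i => (a (i + 1) - a i) / m i with hr
  have hr0 : ∀ i, 0 < r i := fun i =>
    div_pos (sub_pos.2 (ha i.lt_succ_self)) (by exact_mod_cast hm0 i)
  set s : ℕ → ℝ := fun j => a (e j) + ((j : ℝ) - n (e j)) * r (e j) with hs
  have hsval : ∀ i j, n i ≤ j → j < n (i + 1) → s j = a i + ((j : ℝ) - n i) * r i := by
    intro i j h1 h2
    simp only [hs, heq i j h1 h2]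
  have hsn : ∀ i, s (n i) = a i := by
    intro i
    rw [hsval i (n i) le_rfl (hnmono i.lt_succ_self)]
    ring
  have hstep : ∀ i j, n i ≤ j → j < n (i + 1) → s (j + 1) - s j = r i := by
    intro i j h1 h2
    rw [hsval i j h1 h2]
    rcases (Nat.succ_le_of_lt h2).lt_or_eq with h3 | h3
    · rw [hsval i (j + 1) (by omega) h3]
      push_cast
      ring
    · have h4 : j + 1 = n (i + 1) := h3
      have h5 : (j : ℝ) - n i = m i - 1 := by
        have := h4.trans (hnsucc i)
        have h6 : (j : ℝ) + 1 = n i + m i := by exact_mod_cast this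
        linarith
      have hmi : (m i : ℝ) ≠ 0 := by exact_mod_cast (hm0 i).ne'
      rw [h4, hsn, h5, hr]
      field_simp
      ring
  refine ⟨s, n, strictMono_nat_of_lt_succ fun j => ?_, hnmono, hn0, hsn, fun i j h1 h2 => ?_⟩
  · have := hstep _ j (he1 j) (he2 j)
    linarith [hr0 (e j)]
  · rw [hstep i j h1 h2]
    exact hmδ i

/-- The sampling operator `f ↦ (f (s k))ₖ` on `C[0,1]`. It takes values in `c` because `s k → 1`.
-/
noncomputable def samplingLinearMap (s : ℕ → unitInterval) (hs : Tendsto s atTop (𝓝 1)) :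
    C(unitInterval, ℝ) →ₗ[ℝ] convergentSeq where
  toFun f :=
    ⟨(BoundedContinuousFunction.mkOfCompact f).compContinuous ⟨s, continuous_of_discreteTopology⟩,
      f 1, (f.continuous.tendsto 1).comp hs⟩
  map_add' _ _ := rfl
  map_smul' _ _ := rfl

theorem norm_samplingLinearMap_apply_le (s : ℕ → unitInterval) (hs : Tendsto s atTop (𝓝 1))
    (f : C(unitInterval, ℝ)) : ‖samplingLinearMap s hs f‖ ≤ ‖f‖ := by
  have : ‖(samplingLinearMap s hs f : ℕ →ᵇ ℝ)‖ ≤ ‖f‖ :=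
    (BoundedContinuousFunction.norm_le (norm_nonneg f)).2 fun k => f.norm_coe_le_norm (s k)
  exact this

/-- The sampling operator as a bounded operator. -/
noncomputable def samplingCLM (s : ℕ → unitInterval) (hs : Tendsto s atTop (𝓝 1)) :
    C(unitInterval, ℝ) →L[ℝ] convergentSeq where
  toLinearMap := samplingLinearMap s hs
  cont := AddMonoidHomClass.continuous_of_bound (samplingLinearMap s hs) 1 fun f =>
    (norm_samplingLinearMap_apply_le s hs f).trans_eq (one_mul _).symm

theorem norm_samplingCLM_apply_le (s : ℕ → unitInterval) (hs : Tendsto s atTop (𝓝 1))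
    (f : C(unitInterval, ℝ)) : ‖samplingCLM s hs f‖ ≤ ‖f‖ :=
  norm_samplingLinearMap_apply_le s hs f

namespace MuntzSequence

theorem IsBernsteinConstant.abs_sub_le {Λ : MuntzSequence} {b K : ℝ}
    (hK : Λ.IsBernsteinConstant b K) (hb : b ≤ 1) {p : C(unitInterval, ℝ)}
    (hp : p ∈ Λ.polynomials) {u v : unitInterval} (hu : (u : ℝ) ≤ b) (hv : (v : ℝ) ≤ b) :
    |p v - p u| ≤ K * ‖p‖ * |(v : ℝ) - u| := by
  have hex : ∀ t : ℝ, ∃ d, t ∈ Icc 0 b →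
      HasDerivWithinAt (IccExtend (zero_le_one' ℝ) p) d (Icc 0 1) t ∧ |d| ≤ K * ‖p‖ := by
    intro t
    by_cases ht : t ∈ Icc 0 b
    · obtain ⟨d, hd⟩ := hK p hp t ht
      exact ⟨d, fun _ => hd⟩
    · exact ⟨0, fun h => absurd h ht⟩
  choose d hd using hex
  have := (convex_Icc 0 b).norm_image_sub_le_of_norm_hasDerivWithin_le
    (f := IccExtend (zero_le_one' ℝ) p) (f' := d) (C := K * ‖p‖)
    (fun t ht => (hd t ht).1.mono (Icc_subset_Icc_right hb)) (fun t ht => (hd t ht).2)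
    (x := u) (y := v) ⟨u.2.1, hu⟩ ⟨v.2.1, hv⟩
  simpa only [IccExtend_val, Real.norm_eq_abs] using this

/-- The steps `ε / K (i + 1)` are so fine that, by the Bernstein inequality on `[0, a (i + 1)]`, a
Müntz polynomial `p` varies by at most `ε ‖p‖` between neighbouring sample points. -/
theorem sub_mul_norm_le_norm_samplingCLM (Λ : MuntzSequence) {a K : ℕ → ℝ}
    (ha_lt : ∀ i, a i < 1) (hK : ∀ i, 0 < K i ∧ Λ.IsBernsteinConstant (a i) (K i))
    {ε : ℝ} {s : ℕ → unitInterval} {n : ℕ → ℕ} (hs : Tendsto s atTop (𝓝 1)) (hs0 : s 0 = 0)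
    (hs_mono : StrictMono s) (hn : StrictMono n) (hn0 : n 0 = 0)
    (hsn : ∀ i, (s (n i) : ℝ) = a i)
    (hstep : ∀ i j, n i ≤ j → j < n (i + 1) → (s (j + 1) : ℝ) - s j ≤ ε / K (i + 1))
    {f : C(unitInterval, ℝ)} (hf : f ∈ Λ.space) :
    (1 - ε) * ‖f‖ ≤ ‖samplingCLM s hs f‖ := by
  suffices h : ∀ p ∈ Λ.polynomials, (1 - ε) * ‖p‖ ≤ ‖samplingCLM s hs p‖ by
    have hclosed : IsClosed {p : C(unitInterval, ℝ) | (1 - ε) * ‖p‖ ≤ ‖samplingCLM s hs p‖} :=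
      isClosed_le (continuous_const.mul continuous_norm)
        (continuous_norm.comp (continuous_subtype_val.comp (samplingCLM s hs).continuous))
    exact closure_minimal h hclosed hf
  intro p hp
  have hsk : ∀ k, |p (s k)| ≤ ‖samplingCLM s hs p‖ := fun k =>
    (samplingCLM s hs p : ℕ →ᵇ ℝ).norm_coe_le_norm k
  have hε : 0 ≤ ε := by
    have h1 := hstep 0 0 hn0.le (by simpa [hn0] using hn one_pos)
    have h2 : (s 0 : ℝ) < s 1 := hs_mono one_pos
    by_contra h
    have := div_neg_of_neg_of_pos (not_le.1 h) (hK 1).1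
    simp only [zero_add] at h1
    linarith
  have key : ∀ t : unitInterval, |p t| ≤ ‖samplingCLM s hs p‖ + ε * ‖p‖ := by
    intro t
    rcases eq_or_lt_of_le t.2.2 with ht | ht
    · have ht1 : t = 1 := Subtype.ext ht
      have h1 : |p 1| ≤ ‖samplingCLM s hs p‖ :=
        le_of_tendsto (((p.continuous.tendsto 1).comp hs).abs) (Eventually.of_forall hsk)
      rw [ht1]
      have : 0 ≤ ε * ‖p‖ := by positivity
      linarith
    · have hts : ∃ N, t < s N := (hs.eventually_const_lt (show t < 1 from ht)).exists
      obtain ⟨j, hj1, hj2⟩ := exists_le_lt_succ (hs0 ▸ t.2.1 : s 0 ≤ t) hts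
      obtain ⟨i, hi1, hi2⟩ := exists_le_lt_succ (u := n) (x := j) (hn0.le.trans j.zero_le)
        ⟨j + 1, hn.id_le (j + 1)⟩
      have hta : ((s (j + 1) : unitInterval) : ℝ) ≤ a (i + 1) := by
        rw [← hsn]
        exact hs_mono.monotone hi2
      have h1 := (hK (i + 1)).2.abs_sub_le (ha_lt _).le hp
        (u := s j) (v := t) ((Subtype.coe_le_coe.2 (hs_mono j.lt_succ_self).le).trans hta)
        ((Subtype.coe_le_coe.2 hj2.le).trans hta)
      have h2 : |(t : ℝ) - s j| ≤ ε / K (i + 1) := by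
        rw [abs_of_nonneg (sub_nonneg.2 (Subtype.coe_le_coe.2 hj1))]
        have h3 : (t : ℝ) ≤ s (j + 1) := hj2.le
        linarith [hstep i j hi1 hi2]
      have hKpos := (hK (i + 1)).1
      have h4 : K (i + 1) * ‖p‖ * |(t : ℝ) - s j| ≤ ε * ‖p‖ := by
        calc _ ≤ K (i + 1) * ‖p‖ * (ε / K (i + 1)) :=
              mul_le_mul_of_nonneg_left h2 (by positivity)
          _ = ε * ‖p‖ := by field_simp
      have h5 := abs_sub_abs_le_abs_sub (p t : ℝ) (p (s j) : ℝ)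
      linarith [hsk j]
  have := (ContinuousMap.norm_le p ((abs_nonneg _).trans (key 0))).2 key
  linarith

end MuntzSequence

theorem mainTheorem4 (Λ : MuntzSequence) (hΛ : 1 ≤ Λ 1)
    (a : ℕ → ℝ) (ha_zero : a 0 = 0) (ha_mono : StrictMono a) (ha_lt : ∀ i, a i < 1)
    (ha_lim : Tendsto a atTop (𝓝 1)) :
    ∃ K : ℕ → ℝ, (∀ i, 0 < K i ∧ Λ.IsBernsteinConstant (a i) (K i)) ∧
      ∀ ε : ℝ, 0 < ε →
        ∃ (s : ℕ → unitInterval) (n : ℕ → ℕ),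
          StrictMono s ∧ StrictMono n ∧ n 0 = 0 ∧ (∀ i, (s (n i) : ℝ) = a i) ∧
          (∀ i j, n i ≤ j → j < n (i + 1) → (s (j + 1) : ℝ) - (s j : ℝ) ≤ ε / K (i + 1)) ∧
          ∃ J : Λ.space →L[ℝ] convergentSeq,
            (∀ (f : Λ.space) (k : ℕ), (J f : ℕ →ᵇ ℝ) k = (f : C(unitInterval, ℝ)) (s k)) ∧
            ∀ f : Λ.space, (1 - ε) * ‖f‖ ≤ ‖J f‖ ∧ ‖J f‖ ≤ ‖f‖ := by
  choose K hK using fun i => Λ.exists_isBernsteinConstant hΛ (ha_lt i)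
  refine ⟨K, hK, fun ε hε => ?_⟩
  obtain ⟨s, n, hs, hn, hn0, hsn, hstep⟩ :=
    exists_refinement (δ := fun i => ε / K (i + 1)) ha_mono fun i => div_pos hε (hK (i + 1)).1
  have hs0 : s 0 = 0 := by rw [← ha_zero, ← hsn 0, hn0]
  have hle : ∀ j, s j ≤ a j := fun j => hsn j ▸ hs.monotone (hn.id_le j)
  have hmem : ∀ j, s j ∈ Icc (0 : ℝ) 1 := fun j =>
    ⟨hs0 ▸ hs.monotone j.zero_le, (hle j).trans (ha_lt j).le⟩
  have hlim : Tendsto s atTop (𝓝 1) :=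
    (tendsto_iff_tendsto_subseq_of_monotone hs.monotone hn.tendsto_atTop).2
      (ha_lim.congr fun i => (hsn i).symm)
  set s' : ℕ → unitInterval := fun j => ⟨s j, hmem j⟩ with hs'
  have hlim' : Tendsto s' atTop (𝓝 1) := tendsto_subtype_rng.2 hlim
  refine ⟨s', n, fun i j hij => hs hij, hn, hn0, hsn, hstep,
    (samplingCLM s' hlim').comp Λ.space.subtypeL, fun f k => rfl, fun f => ⟨?_, ?_⟩⟩
  · exact Λ.sub_mul_norm_le_norm_samplingCLM ha_lt hK hlim' (Subtype.ext hs0)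
      (fun i j hij => hs hij) hn hn0 hsn hstep f.2
  · exact norm_samplingCLM_apply_le s' hlim' f
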